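/- **Theorem (logarithmic bound at a sink).** For two curves $\gamma_1,\gamma_2$ in $\mathbb R^3$ with parameters in $T_1,T_2\subset\mathbb R$, let $$R_{abs}(\gamma_1,\gamma_2)=\frac1{4\pi}\int_{T_1}\int_{T_2}\frac{|\langle\gamma_1'(t_1)\wedge\gamma_2'(t_2),\,\gamma_2(t_2)-\gamma_1(t_1)\rangle|}{\|\gamma_2(t_2)-\gamma_1(t_1)\|^3}\,dt_2\,dt_1\in[0,\infty]$$ be their absolute rotation. For every $q>1$ there is a constant $c>0$, depending only on $q$, with the following property. Let $v$ be a vector field that is analytic in a neighbourhood of the origin $O\in\mathbb R^3$, with $v(O)=0$ and linear part $L=Dv(O)$, and let $\ell<0$ be such that every complex eigenvalue $\ell_j$ of $L$ satisfies $\operatorname{Re}\ell_j\le\ell$. Write $\|L\|$ for the Euclidean operator norm and $\kappa=\|L\|/|\ell|$ (so $\kappa\ge 1$). Then there is a neighbourhood $U$ of $O$ such that for any two trajectories $\omega_1,\omega_2$ of $v$ lying in $U$ (defined on arbitrary time intervals) and all $r>0$, $R\ge q\,r$, the absolute rotation $R_{abs}(\omega_1,\omega_2,R,r)$ of the parts of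 $\omega_1,\omega_2$ in the closed shell $r\le\|x\|\le R$ satisfies $$R_{abs}(\omega_1,\omega_2,R,r)\le C\,\|L\|\,\frac{\log^2(R/r)}{|\ell|},\qquad C=c\,\kappa\,(1+\log\kappa)^2 ,$$ and, if moreover $R/r\ge e\,\kappa$, the same inequality holds with $C=c\,\kappa$, that is, $$R_{abs}(\omega_1,\omega_2,R,r)\le c\,\frac{\|L\|^2}{\ell^2}\,\log^2(R/r).$$ -/

import Mathlib

open MeasureTheory
open scoped ENNReal Topology

noncomputable section

/-- Euclidean three-space. -/
abbrev E3 : Type := EuclideanSpace ℝ (Fin 3)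

/-- The vector product `a ∧ b` of two vectors of Euclidean three-space. -/
def wedge (a b : E3) : E3 := WithLp.toLp 2 (crossProduct a.ofLp b.ofLp)

/-- The absolute rotation (absolute Gauss integral) of the curves `γ₁`, `γ₂`, restricted to the
parameter sets `I₁`, `I₂`, with values in `[0, ∞]` (so that a bound on it includes convergence of
the integral):
`(1 / 4π) ∫_{I₁} ∫_{I₂} |⟨γ₁' ∧ γ₂', γ₂ - γ₁⟩| / ‖γ₂ - γ₁‖³ dt₂ dt₁`. -/
def absRotation (γ₁ γ₂ : ℝ → E3) (I₁ I₂ : Set ℝ) : ℝ≥0∞ :=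
  ENNReal.ofReal (1 / (4 * Real.pi)) *
    ∫⁻ t₁ in I₁, ∫⁻ t₂ in I₂,
      ENNReal.ofReal
        (|inner ℝ (wedge (deriv γ₁ t₁) (deriv γ₂ t₂)) (γ₂ t₂ - γ₁ t₁)| /
          ‖γ₂ t₂ - γ₁ t₁‖ ^ 3)

/-- `ω`, on the time interval `I` (open, closed or half-open, bounded or not), is a trajectory
of the vector field `v` that lies in `U`. -/
structure IsTrajectoryIn (v : E3 → E3) (U : Set E3) (I : Set ℝ) (ω : ℝ → E3) : Prop where
  interval : I.OrdConnected
  mem : ∀ t ∈ I, ω t ∈ U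
  hasDeriv : ∀ t ∈ I, HasDerivWithinAt ω (v (ω t)) I t

/-- The parameters of the part of `ω` between the spheres of radii `r` and `R` about the origin
(the spheres included). -/
def shellPart (ω : ℝ → E3) (I : Set ℝ) (r R : ℝ) : Set ℝ :=
  {t | t ∈ I ∧ r ≤ ‖ω t‖ ∧ ‖ω t‖ ≤ R}

/-- `z` is a (real or complex) eigenvalue of the real linear map `L`, i.e. an eigenvalue of its
complexification. -/
def IsComplexEigenvalue (L : E3 →L[ℝ] E3) (z : ℂ) : Prop :=
  Module.End.HasEigenvalue ((L : E3 →ₗ[ℝ] E3).baseChange ℂ) z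

end

/-! Near the sink `v` is Lipschitz with constant `Λ = 2 ‖L‖`. Let `x = γ₁(t₁)`, `p = v x`, and let
`w` join `x` to the other trajectory, whose velocity is `p'`. Only `p' - p` contributes to `p ∧ p'`,
and `‖p' - p‖ ≤ Λ ‖w‖`, so the Gauss integrand is at most `Λ ‖p ∧ w‖ / ‖w‖²`: one power of the
singularity is gained (`gauss_integrand_le`). During a time `1 / (10 Λ)` the second trajectory moves
almost uniformly with velocity `p`, unless `‖p‖` is small compared with `Λ ‖w‖`. Then `‖p ∧ w‖ /
‖w‖²` is, up to `O(Λ)`, bounded by a Cauchy kernel in time, whose integral is at most `π` whatever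
the speed and the distance (`wedge_div_sq_le`, `lintegral_cauchy_kernel_le`). Each such window costs
`O(Λ)`, so two pieces of duration `T ≥ 1 / Λ` have rotation `O((Λ T)²)` (`absRotation_le`). It
remains to bound the time between two visits to the shell. Weighting the Schur coordinates of `L`
gives a quadratic Lyapunov function with decay proportional to `|ℓ|` and distortion `4 κ²`. The
distortion enters only through its logarithm, so `T = O((log (R / r) + log κ + 1) / |ℓ|)`
(`exists_lyapunov`, `abs_sub_le_of_mem_shellPart`). Finally `κ² = κ ‖L‖ / |ℓ|`, and the terms `log κ
+ 1` are absorbed using `R / r ≥ q` or `R / r ≥ e κ`. -/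

/-! ### Pointwise bound of the Gauss integrand; the Cauchy kernel. -/

theorem inner_wedge_eq (a b c : E3) :
    inner ℝ (wedge a b) c = (a 1 * b 2 - a 2 * b 1) * c 0 + (a 2 * b 0 - a 0 * b 2) * c 1 +
      (a 0 * b 1 - a 1 * b 0) * c 2 := by
  simp [wedge, PiLp.inner_apply, Fin.sum_univ_three, cross_apply]
  ring

theorem wedge_add_right (a b c : E3) : wedge a (b + c) = wedge a b + wedge a c := by
  simp [wedge]

theorem wedge_smul_right (a : E3) (s : ℝ) (b : E3) : wedge a (s • b) = s • wedge a b := by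
  simp [wedge]

theorem wedge_self_eq_zero (a : E3) : wedge a a = 0 := by
  simp [wedge]

theorem norm_wedge_le (a b : E3) : ‖wedge a b‖ ≤ ‖a‖ * ‖b‖ := by
  refine abs_le_of_sq_le_sq' ?_ (by positivity) |>.2
  rw [mul_pow, EuclideanSpace.real_norm_sq_eq, EuclideanSpace.real_norm_sq_eq,
    EuclideanSpace.real_norm_sq_eq]
  simp only [wedge, cross_apply, Fin.sum_univ_three]
  simp
  nlinarith [sq_nonneg (a 0 * b 0 + a 1 * b 1 + a 2 * b 2)]

theorem inner_wedge_comm (a b c : E3) : inner ℝ (wedge a b) c = -inner ℝ (wedge a c) b := by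
  rw [inner_wedge_eq, inner_wedge_eq]
  ring

theorem abs_inner_wedge_le (a b c : E3) : |inner ℝ (wedge a b) c| ≤ ‖wedge a c‖ * ‖b‖ := by
  rw [inner_wedge_comm, abs_neg]
  exact abs_real_inner_le_norm _ _

/-- The Gauss integrand at two points `x`, `x + w` with velocities `p`, `p'` is small when the
velocities differ by at most `Λ ‖w‖`. -/
theorem gauss_integrand_le {Λ : ℝ} {p p' w : E3} (h : ‖p' - p‖ ≤ Λ * ‖w‖) :
    |inner ℝ (wedge p p') w| / ‖w‖ ^ 3 ≤ Λ * (‖wedge p w‖ / ‖w‖ ^ 2) := by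
  have h1 : inner ℝ (wedge p p') w = inner ℝ (wedge p (p' - p)) w := by
    conv_lhs => rw [← add_sub_cancel p p', wedge_add_right, wedge_self_eq_zero, zero_add]
  rcases eq_or_ne w 0 with rfl | hw
  · simp
  have hw : 0 < ‖w‖ := norm_pos_iff.2 hw
  rw [h1, div_le_iff₀ (by positivity)]
  refine (abs_inner_wedge_le _ _ _).trans ((mul_le_mul_of_nonneg_left h (norm_nonneg _)).trans_eq ?_)
  field_simp

/-- Rescaling time by `k / ρ` turns the kernel into `1 / (1 + s²)`. Uniformity in `ρ` is what makes
close passages harmless; the degenerate cases `k = 0` and `ρ = 0` give zero. -/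
theorem lintegral_cauchy_kernel_le {k ρ : ℝ} (hk : 0 ≤ k) (hρ : 0 ≤ ρ) (s₁ : ℝ) :
    ∫⁻ s : ℝ, ENNReal.ofReal (k * ρ / (ρ ^ 2 + k ^ 2 * (s - s₁) ^ 2)) ≤ ENNReal.ofReal Real.pi := by
  rcases hk.eq_or_lt with rfl | hk
  · simp
  rcases hρ.eq_or_lt with rfl | hρ
  · simp
  have hc : 0 < k / ρ := by positivity
  have key : ∀ s : ℝ, k * ρ / (ρ ^ 2 + k ^ 2 * (s - s₁) ^ 2) =
      (k / ρ) * (1 + ((k / ρ) * (s - s₁)) ^ 2)⁻¹ := by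
    intro s
    field_simp
  have hint : Integrable fun s : ℝ => (k / ρ) * (1 + ((k / ρ) * (s - s₁)) ^ 2)⁻¹ :=
    ((integrable_inv_one_add_sq.comp_mul_left' hc.ne').comp_sub_right s₁).const_mul _
  simp_rw [key]
  rw [← ofReal_integral_eq_lintegral_ofReal hint (ae_of_all _ fun s => by positivity)]
  refine ENNReal.ofReal_le_ofReal (le_of_eq ?_)
  rw [integral_const_mul,
    integral_sub_right_eq_self (fun s : ℝ => (1 + ((k / ρ) * s) ^ 2)⁻¹) s₁,
    Measure.integral_comp_mul_left (fun s : ℝ => (1 + s ^ 2)⁻¹), integral_univ_inv_one_add_sq,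
    abs_of_pos (by positivity), smul_eq_mul]
  field_simp

/-! ### Rotation about a moving point over one short time window. -/

section Displacement

variable {v : E3 → E3} {U : Set E3} {Λ : ℝ} {γ : ℝ → E3} {s₁ s : ℝ} {x : E3}

/-- Over a time short compared with `1 / Λ`, a trajectory of a `Λ`-Lipschitz field that starts
close to `x` moves almost like a point with the constant velocity `v x`. -/
theorem norm_sub_sub_smul_le (hΛ : 0 ≤ Λ) (hv : ∀ y ∈ U, ‖v y - v x‖ ≤ Λ * ‖y - x‖)
    (hγ : IsTrajectoryIn v U (Set.uIcc s₁ s) γ) (hs : Λ * |s - s₁| ≤ 1 / 10)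
    (hx : 10 * (Λ * ‖γ s₁ - x‖) ≤ ‖v x‖) :
    ‖γ s - γ s₁ - (s - s₁) • v x‖ ≤
      Λ * (‖γ s₁ - x‖ + 11 / 9 * (‖v x‖ * |s - s₁|)) * |s - s₁| := by
  have hcont : ContinuousOn (fun t => ‖γ t - γ s₁‖) (Set.uIcc s₁ s) :=
    (ContinuousOn.sub (fun t ht => (hγ.hasDeriv t ht).continuousWithinAt)
      continuousOn_const).norm
  obtain ⟨s₂, hs₂, hmax⟩ := isCompact_uIcc.exists_isMaxOn Set.nonempty_uIcc hcont
  set m := ‖γ s₂ - γ s₁‖ with hm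
  have hm0 : 0 ≤ m := norm_nonneg _
  set ρ := ‖γ s₁ - x‖ with hρ
  have hρ0 : 0 ≤ ρ := norm_nonneg _
  set τ := |s - s₁| with hτ
  have hτ0 : 0 ≤ τ := abs_nonneg _
  have hd : ∀ t ∈ Set.uIcc s₁ s, ‖v (γ t) - v x‖ ≤ Λ * (ρ + m) := by
    intro t ht
    refine (hv _ (hγ.mem t ht)).trans (mul_le_mul_of_nonneg_left ?_ hΛ)
    have h1 : ‖γ t - γ s₁‖ ≤ m := hmax ht
    calc ‖γ t - x‖ = ‖(γ s₁ - x) + (γ t - γ s₁)‖ := by congr 1; abel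
      _ ≤ ρ + m := (norm_add_le _ _).trans (by linarith)
  have hm1 : m ≤ (‖v x‖ + Λ * (ρ + m)) * τ := by
    have h1 : ∀ t ∈ Set.uIcc s₁ s, ‖v (γ t)‖ ≤ ‖v x‖ + Λ * (ρ + m) := by
      intro t ht
      calc ‖v (γ t)‖ = ‖v x + (v (γ t) - v x)‖ := by congr 1; abel
        _ ≤ _ := (norm_add_le _ _).trans (by linarith [hd t ht])
    have h2 := (convex_uIcc s₁ s).norm_image_sub_le_of_norm_hasDerivWithin_le
      hγ.hasDeriv h1 Set.left_mem_uIcc hs₂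
    refine h2.trans (mul_le_mul_of_nonneg_left ?_ (by positivity))
    exact Set.abs_sub_left_of_mem_uIcc hs₂
  -- The maximal displacement `m` bounds itself: the term `Λ τ m ≤ m / 10` is absorbed on the left,
  -- leaving `9/10 m ≤ 11/10 ‖v x‖ τ`.
  have hm2 : m ≤ 11 / 9 * (‖v x‖ * τ) := by
    have e1 : Λ * τ * m ≤ 1 / 10 * m := mul_le_mul_of_nonneg_right hs hm0
    have e2 : 10 * (Λ * ρ) * τ ≤ ‖v x‖ * τ := mul_le_mul_of_nonneg_right hx hτ0
    nlinarith
  have h3 := (convex_uIcc s₁ s).norm_image_sub_le_of_norm_hasDerivWithin_le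
    (f := fun t => γ t - t • v x) (f' := fun t => v (γ t) - v x)
    (fun t ht => by
      simpa [Pi.sub_def] using
        (hγ.hasDeriv t ht).sub ((hasDerivWithinAt_id t _).smul_const (v x)))
    hd Set.left_mem_uIcc Set.right_mem_uIcc
  have e3 : γ s - s • v x - (γ s₁ - s₁ • v x) = γ s - γ s₁ - (s - s₁) • v x := by
    rw [sub_smul]; abel
  rw [e3] at h3
  refine h3.trans (mul_le_mul_of_nonneg_right (mul_le_mul_of_nonneg_left ?_ hΛ) hτ0)
  linarith

/-- Write `w = (γ s₁ - x) + (s - s₁) p + e` with `p = v x` and `e` small. Wedging with `p` kills the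
middle term, the only one that grows at full speed. The denominator is bounded below both by the
minimal distance and by `3/8 ‖p‖ |s - s₁|`, hence by half the sum of their squares. -/
theorem wedge_div_sq_le (hΛ : 0 ≤ Λ) (hv : ∀ y ∈ U, ‖v y - v x‖ ≤ Λ * ‖y - x‖)
    (hγ : IsTrajectoryIn v U (Set.uIcc s₁ s) γ) (hs : Λ * |s - s₁| ≤ 1 / 10)
    (hx : 10 * (Λ * ‖γ s₁ - x‖) ≤ ‖v x‖) (hmin : ‖γ s₁ - x‖ ≤ ‖γ s - x‖) :
    ‖wedge (v x) (γ s - x)‖ / ‖γ s - x‖ ^ 2 ≤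
      10 * Λ + 6 * ((3 / 8 * ‖v x‖) * ‖γ s₁ - x‖ /
        (‖γ s₁ - x‖ ^ 2 + (3 / 8 * ‖v x‖) ^ 2 * (s - s₁) ^ 2)) := by
  have hdisp := norm_sub_sub_smul_le hΛ hv hγ hs hx
  set p := v x with hp
  set w := γ s - x with hw
  set ρ := ‖γ s₁ - x‖ with hρ
  have hρ0 : 0 ≤ ρ := norm_nonneg _
  rw [← sq_abs (s - s₁)]
  set τ := |s - s₁| with hτ
  have hτ0 : 0 ≤ τ := abs_nonneg _
  set e := γ s - γ s₁ - (s - s₁) • p with he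
  have hp0 : 0 ≤ ‖p‖ := norm_nonneg _
  have h1 : Λ * ρ * τ ≤ 1 / 10 * (‖p‖ * τ) := by nlinarith
  have h2 : Λ * ρ * τ ≤ 1 / 10 * ρ := by nlinarith
  have hwlow : 3 / 8 * ‖p‖ * τ ≤ ‖w‖ := by
    have hwe : (s - s₁) • p = w - (γ s₁ - x) - e := by
      rw [he, hw]; abel
    have : τ * ‖p‖ ≤ ‖w‖ + ρ + ‖e‖ := by
      calc τ * ‖p‖ = ‖(s - s₁) • p‖ := by rw [norm_smul, Real.norm_eq_abs]
        _ ≤ _ := by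
          rw [hwe]
          exact (norm_sub_le _ _).trans (by gcongr; exact norm_sub_le _ _)
    have h3 : Λ * τ * (‖p‖ * τ) ≤ 1 / 10 * (‖p‖ * τ) :=
      mul_le_mul_of_nonneg_right hs (by positivity)
    nlinarith
  have hwedge : ‖wedge p w‖ ≤ ‖p‖ * (11 / 10 * ρ + 11 / 9 * (Λ * ‖p‖ * τ ^ 2)) := by
    have hwe : w = (γ s₁ - x) + (s - s₁) • p + e := by
      rw [he, hw]; abel
    rw [hwe, wedge_add_right, wedge_add_right, wedge_smul_right, wedge_self_eq_zero, smul_zero,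
      add_zero]
    have h3 : ‖e‖ ≤ Λ * ρ * τ + 11 / 9 * (Λ * ‖p‖ * τ ^ 2) := hdisp.trans_eq (by ring)
    calc _ ≤ ‖p‖ * ρ + ‖p‖ * ‖e‖ :=
          (norm_add_le _ _).trans (add_le_add (norm_wedge_le _ _) (norm_wedge_le _ _))
      _ = ‖p‖ * (ρ + ‖e‖) := by ring
      _ ≤ _ := mul_le_mul_of_nonneg_left (by linarith) hp0
  rcases (norm_nonneg w).eq_or_lt with hw0 | hw0
  · rw [← hw0]; simp only [ne_eq, OfNat.ofNat_ne_zero, not_false_eq_true, zero_pow, div_zero]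
    positivity
  set k := 3 / 8 * ‖p‖ with hk
  have hk0 : 0 ≤ k := by positivity
  have hpk : ‖p‖ = 8 / 3 * k := by rw [hk]; ring
  have hsq1 : ρ ^ 2 ≤ ‖w‖ ^ 2 := by gcongr
  have hsq2 : k ^ 2 * τ ^ 2 ≤ ‖w‖ ^ 2 := by rw [← mul_pow]; gcongr
  have hfirst : k * ρ / ‖w‖ ^ 2 ≤ 2 * (k * ρ / (ρ ^ 2 + k ^ 2 * τ ^ 2)) := by
    rcases hρ0.eq_or_lt with h0 | h0
    · rw [← h0]; simp
    rw [div_le_iff₀ (by positivity), ← mul_div_assoc, div_mul_eq_mul_div, le_div_iff₀ (by positivity)]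
    have : 0 ≤ k * ρ := by positivity
    nlinarith
  have hsecond : Λ * (k ^ 2 * τ ^ 2) / ‖w‖ ^ 2 ≤ Λ := by
    rw [div_le_iff₀ (by positivity)]; gcongr
  have h4 : ‖wedge p w‖ / ‖w‖ ^ 2 ≤
      88 / 30 * (k * ρ / ‖w‖ ^ 2) + 704 / 81 * (Λ * (k ^ 2 * τ ^ 2) / ‖w‖ ^ 2) := by
    rw [div_le_iff₀ (by positivity)]
    refine hwedge.trans (le_of_eq ?_)
    rw [hpk]
    field_simp
    ring
  have h5 : 0 ≤ k * ρ / (ρ ^ 2 + k ^ 2 * τ ^ 2) := by positivity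
  linarith

end Displacement

/-- The rotation of a short trajectory of a `Λ`-Lipschitz field about a point moving with the field
is at most a multiple of `Λ` per unit of time. -/
theorem lintegral_gauss_integrand_le {v : E3 → E3} {U : Set E3} {Λ : ℝ} {γ : ℝ → E3} {a b : ℝ}
    {x : E3} (hΛ : 0 ≤ Λ) (hv : ∀ y ∈ U, ‖v y - v x‖ ≤ Λ * ‖y - x‖)
    (hγ : IsTrajectoryIn v U (Set.Icc a b) γ) (hab : Λ * (b - a) ≤ 1 / 10) :
    ∫⁻ s in Set.Icc a b,
      ENNReal.ofReal (|inner ℝ (wedge (v x) (v (γ s))) (γ s - x)| / ‖γ s - x‖ ^ 3) ≤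
      ENNReal.ofReal (20 * Λ) := by
  rcases lt_or_ge b a with hba | hba
  · simp [Set.Icc_eq_empty_of_lt hba]
  have hcont : ContinuousOn (fun t => ‖γ t - x‖) (Set.Icc a b) :=
    (ContinuousOn.sub (fun t ht => (hγ.hasDeriv t ht).continuousWithinAt)
      continuousOn_const).norm
  obtain ⟨s₁, hs₁, hmin⟩ := isCompact_Icc.exists_isMinOn (Set.nonempty_Icc.2 hba) hcont
  set ρ := ‖γ s₁ - x‖ with hρ
  have hρ0 : 0 ≤ ρ := norm_nonneg _
  set k := 3 / 8 * ‖v x‖ with hk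
  have hk0 : 0 ≤ k := by positivity
  have hpt : ∀ s ∈ Set.Icc a b,
      |inner ℝ (wedge (v x) (v (γ s))) (γ s - x)| / ‖γ s - x‖ ^ 3 ≤
        10 * Λ ^ 2 + 6 * Λ * (k * ρ / (ρ ^ 2 + k ^ 2 * (s - s₁) ^ 2)) := by
    intro s hs
    have hmins : ρ ≤ ‖γ s - x‖ := hmin hs
    refine (gauss_integrand_le (hv _ (hγ.mem s hs))).trans ?_
    rw [show 10 * Λ ^ 2 + 6 * Λ * (k * ρ / (ρ ^ 2 + k ^ 2 * (s - s₁) ^ 2)) =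
      Λ * (10 * Λ + 6 * (k * ρ / (ρ ^ 2 + k ^ 2 * (s - s₁) ^ 2))) by ring]
    refine mul_le_mul_of_nonneg_left ?_ hΛ
    have hsub : Set.uIcc s₁ s ⊆ Set.Icc a b := Set.uIcc_subset_Icc hs₁ hs
    rcases le_or_gt (10 * (Λ * ρ)) ‖v x‖ with hx | hx
    · refine wedge_div_sq_le hΛ hv
        ⟨Set.ordConnected_uIcc, fun t ht => hγ.mem t (hsub ht),
          fun t ht => (hγ.hasDeriv t (hsub ht)).mono hsub⟩ ?_ hx hmins
      refine (mul_le_mul_of_nonneg_left ?_ hΛ).trans hab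
      exact abs_sub_le_of_le_of_le hs.1 hs.2 hs₁.1 hs₁.2
    -- When `‖v x‖ < 10 Λ ρ` no kernel is needed: `‖p ∧ w‖ / ‖w‖² ≤ ‖p‖ / ‖w‖ ≤ 10 Λ`, since `ρ` is
    -- the minimal distance.
    · have h5 : 0 ≤ k * ρ / (ρ ^ 2 + k ^ 2 * (s - s₁) ^ 2) := by positivity
      suffices ‖wedge (v x) (γ s - x)‖ / ‖γ s - x‖ ^ 2 ≤ 10 * Λ by linarith
      rcases (norm_nonneg (γ s - x)).eq_or_lt with hw0 | hw0
      · rw [← hw0]; simp only [ne_eq, OfNat.ofNat_ne_zero, not_false_eq_true, zero_pow, div_zero]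
        positivity
      rw [div_le_iff₀ (by positivity)]
      refine (norm_wedge_le _ _).trans ?_
      have : Λ * ρ ≤ Λ * ‖γ s - x‖ := mul_le_mul_of_nonneg_left hmins hΛ
      nlinarith
  calc _ ≤ ∫⁻ s in Set.Icc a b, (ENNReal.ofReal (10 * Λ ^ 2) + ENNReal.ofReal (6 * Λ) *
        ENNReal.ofReal (k * ρ / (ρ ^ 2 + k ^ 2 * (s - s₁) ^ 2))) := by
        refine setLIntegral_mono' measurableSet_Icc fun s hs => ?_
        rw [← ENNReal.ofReal_mul (by positivity), ← ENNReal.ofReal_add (by positivity)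
          (by positivity)]
        exact ENNReal.ofReal_le_ofReal (hpt s hs)
    _ = ENNReal.ofReal (10 * Λ ^ 2) * ENNReal.ofReal (b - a) + ENNReal.ofReal (6 * Λ) *
        ∫⁻ s in Set.Icc a b, ENNReal.ofReal (k * ρ / (ρ ^ 2 + k ^ 2 * (s - s₁) ^ 2)) := by
        rw [lintegral_add_left measurable_const, setLIntegral_const, Real.volume_Icc,
          lintegral_const_mul' _ _ ENNReal.ofReal_ne_top]
    _ ≤ ENNReal.ofReal (10 * Λ ^ 2) * ENNReal.ofReal (b - a) + ENNReal.ofReal (6 * Λ) *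
        ENNReal.ofReal Real.pi := by
        gcongr
        exact (setLIntegral_le_lintegral _ _).trans (lintegral_cauchy_kernel_le hk0 hρ0 s₁)
    _ ≤ ENNReal.ofReal (20 * Λ) := by
        rw [← ENNReal.ofReal_mul (by positivity), ← ENNReal.ofReal_mul (by positivity),
          ← ENNReal.ofReal_add (mul_nonneg (by positivity) (sub_nonneg.2 hba)) (by positivity)]
        -- `10 Λ² (b - a) ≤ Λ`, and `1 + 6 π < 20`.
        refine ENNReal.ofReal_le_ofReal ?_
        have := Real.pi_lt_d2
        nlinarith

/-! ### Schur form of a real operator. -/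

/-- Schur triangularization: a complex operator is upper triangular in a suitable orthonormal
basis. -/
theorem exists_orthonormalBasis_triangular (n : ℕ) :
    ∀ (V : Type) [NormedAddCommGroup V] [InnerProductSpace ℂ V] [FiniteDimensional ℂ V]
      (f : V →ₗ[ℂ] V), Module.finrank ℂ V = n →
      ∃ b : OrthonormalBasis (Fin n) ℂ V, ∀ i j, j < i → inner ℂ (b i) (f (b j)) = 0 := by
  induction n with
  | zero =>
    intro V _ _ _ f hV
    exact ⟨(stdOrthonormalBasis ℂ V).reindex (finCongr hV), fun i => i.elim0⟩
  | succ n ih =>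
    intro V _ _ _ f hV
    have : Nontrivial V := Module.nontrivial_of_finrank_pos (R := ℂ) (by omega)
    obtain ⟨μ, hμ⟩ := Module.End.exists_eigenvalue f
    obtain ⟨e, he⟩ := hμ.exists_hasEigenvector
    have he0 : e ≠ 0 := he.2
    have hdim : Module.finrank ℂ (ℂ ∙ e)ᗮ = n := by
      have h1 := (ℂ ∙ e).finrank_add_finrank_orthogonal
      rw [finrank_span_singleton he0] at h1
      omega
    -- The induction applies to the compression of `f` to the complement of an eigenvector.
    -- Projecting does not change inner products with vectors of that complement.
    obtain ⟨b, hb⟩ := ih (ℂ ∙ e)ᗮ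
      (((ℂ ∙ e)ᗮ.orthogonalProjectionOnto : V →ₗ[ℂ] (ℂ ∙ e)ᗮ) ∘ₗ f ∘ₗ (ℂ ∙ e)ᗮ.subtype) hdim
    set u : V := ((‖e‖ : ℂ)⁻¹) • e with hu
    have hue : ∀ w : (ℂ ∙ e)ᗮ, inner ℂ u (w : V) = 0 := fun w => by
      rw [hu, inner_smul_left, Submodule.mem_orthogonal_singleton_iff_inner_right.1 w.2, mul_zero]
    have hunorm : ‖u‖ = 1 := by
      rw [hu, norm_smul]
      simp [he0]
    have hon : Orthonormal ℂ (Fin.cons u (fun i => (b i : V)) : Fin (n + 1) → V) := by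
      rw [orthonormal_iff_ite]
      intro i j
      refine Fin.cases ?_ (fun i => ?_) i <;> refine Fin.cases ?_ (fun j => ?_) j
      · simp [inner_self_eq_norm_sq_to_K, hunorm]
      · simp [hue, (Fin.succ_ne_zero j).symm]
      · simp [← inner_conj_symm (b i : V) u, hue]
      · have := orthonormal_iff_ite.1 b.orthonormal i j
        simpa using this
    have hspan : Submodule.span ℂ (Set.range (Fin.cons u (fun i => (b i : V)) : Fin (n + 1) → V))
        = ⊤ := hon.linearIndependent.span_eq_top_of_card_eq_finrank' (by simp [hV])
    refine ⟨OrthonormalBasis.mk hon hspan.ge, ?_⟩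
    intro i j hij
    simp only [OrthonormalBasis.coe_mk]
    obtain ⟨i, rfl⟩ := Fin.exists_succ_eq.2 (Fin.ne_zero_of_lt hij)
    revert hij
    refine Fin.cases (fun _ => ?_) (fun j hij => ?_) j
    · have hfu : f u = μ • u := by rw [hu, map_smul, he.apply_eq_smul, smul_comm]
      simp [hfu, ← inner_conj_symm (b i : V) u, hue]
    · have := hb i j (Fin.succ_lt_succ_iff.1 hij)
      simpa using this

/-- Complexification of a real vector. -/
def complexVec (x : E3) : EuclideanSpace ℂ (Fin 3) := WithLp.toLp 2 fun i => (x i : ℂ)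

/-- Complexification of a real operator. -/
noncomputable def complexOp (L : E3 →L[ℝ] E3) :
    EuclideanSpace ℂ (Fin 3) →ₗ[ℂ] EuclideanSpace ℂ (Fin 3) :=
  Matrix.toLin (EuclideanSpace.basisFun (Fin 3) ℂ).toBasis (EuclideanSpace.basisFun (Fin 3) ℂ).toBasis
    ((LinearMap.toMatrix (EuclideanSpace.basisFun (Fin 3) ℝ).toBasis
      (EuclideanSpace.basisFun (Fin 3) ℝ).toBasis (L : E3 →ₗ[ℝ] E3)).map (algebraMap ℝ ℂ))

theorem complexOp_complexVec (L : E3 →L[ℝ] E3) (x : E3) :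
    complexOp L (complexVec x) = complexVec (L x) := by
  ext i
  have h := LinearMap.toMatrix_mulVec_repr (EuclideanSpace.basisFun (Fin 3) ℝ).toBasis
    (EuclideanSpace.basisFun (Fin 3) ℝ).toBasis (L : E3 →ₗ[ℝ] E3) x
  have h2 := congrArg (algebraMap ℝ ℂ) (congrFun h i)
  have h3 := congrFun (LinearMap.toMatrix_mulVec_repr (EuclideanSpace.basisFun (Fin 3) ℂ).toBasis
    (EuclideanSpace.basisFun (Fin 3) ℂ).toBasis (complexOp L) (complexVec x)) i
  rw [complexOp, LinearMap.toMatrix_toLin] at h3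
  simp only [Matrix.mulVec, dotProduct, map_sum, map_mul] at h2 h3
  simp [complexVec, complexOp] at h2 h3 ⊢
  rw [← h2, ← h3]

theorem norm_sq_complexVec_add (x y : E3) :
    ‖complexVec x + Complex.I • complexVec y‖ ^ 2 = ‖x‖ ^ 2 + ‖y‖ ^ 2 := by
  rw [EuclideanSpace.norm_sq_eq, EuclideanSpace.real_norm_sq_eq, EuclideanSpace.real_norm_sq_eq,
    ← Finset.sum_add_distrib]
  refine Finset.sum_congr rfl fun i _ => ?_
  rw [← Complex.normSq_eq_norm_sq, Complex.normSq_apply]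
  simp [complexVec]
  ring

theorem norm_complexVec (x : E3) : ‖complexVec x‖ = ‖x‖ := by
  have h := norm_sq_complexVec_add x 0
  have h0 : complexVec 0 = 0 := by ext i; simp [complexVec]
  rw [h0] at h
  simpa using h

theorem exists_eq_complexVec_add (u : EuclideanSpace ℂ (Fin 3)) :
    ∃ x y : E3, u = complexVec x + Complex.I • complexVec y := by
  refine ⟨WithLp.toLp 2 fun i => (u i).re, WithLp.toLp 2 fun i => (u i).im, ?_⟩
  ext i
  simp [complexVec, mul_comm Complex.I]

/-- The operator acts separately on real and imaginary parts, and squared norms add. -/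
theorem norm_complexOp_le (L : E3 →L[ℝ] E3) (u : EuclideanSpace ℂ (Fin 3)) :
    ‖complexOp L u‖ ≤ ‖L‖ * ‖u‖ := by
  obtain ⟨x, y, rfl⟩ := exists_eq_complexVec_add u
  rw [map_add, map_smul, complexOp_complexVec, complexOp_complexVec]
  refine abs_le_of_sq_le_sq' ?_ (by positivity) |>.2
  rw [mul_pow, norm_sq_complexVec_add, norm_sq_complexVec_add, mul_add, ← mul_pow, ← mul_pow]
  gcongr <;> exact L.le_opNorm _

/-- Both complexifications have the characteristic polynomial of `L`, mapped to `ℂ`. -/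
theorem isComplexEigenvalue_of_isRoot {L : E3 →L[ℝ] E3} {z : ℂ}
    (hz : (complexOp L).charpoly.IsRoot z) : IsComplexEigenvalue L z := by
  rw [IsComplexEigenvalue, Module.End.hasEigenvalue_iff_isRoot_charpoly,
    LinearMap.charpoly_baseChange]
  rwa [← LinearMap.charpoly_toMatrix (complexOp L) (EuclideanSpace.basisFun (Fin 3) ℂ).toBasis,
    complexOp, LinearMap.toMatrix_toLin, Matrix.charpoly_map, LinearMap.charpoly_toMatrix] at hz

/-- Schur form of a real operator of three-space, in unitary coordinates `φ`. -/
theorem exists_triangular_coordinates (L : E3 →L[ℝ] E3) :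
    ∃ (φ : Fin 3 → E3 →L[ℝ] ℂ) (T : Matrix (Fin 3) (Fin 3) ℂ),
      (∀ x, ∑ i, ‖φ i x‖ ^ 2 = ‖x‖ ^ 2) ∧ (∀ i x, φ i (L x) = ∑ j, T i j * φ j x) ∧
      (∀ i j, j < i → T i j = 0) ∧ (∀ i j, ‖T i j‖ ≤ ‖L‖) ∧
      ∀ i, IsComplexEigenvalue L (T i i) := by
  obtain ⟨b, hb⟩ := exists_orthonormalBasis_triangular 3 (EuclideanSpace ℂ (Fin 3)) (complexOp L)
    (by simp)
  have hT : ∀ i j, LinearMap.toMatrix b.toBasis b.toBasis (complexOp L) i j =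
      inner ℂ (b i) (complexOp L (b j)) := fun i j => by
    simp [LinearMap.toMatrix_apply, OrthonormalBasis.repr_apply_apply]
  let φ : Fin 3 → E3 →ₗ[ℝ] ℂ := fun i =>
    { toFun := fun x => inner ℂ (b i) (complexVec x)
      map_add' := fun x y => by
        rw [← inner_add_right]; congr 1; ext j; simp [complexVec]
      map_smul' := fun r x => by
        rw [RingHom.id_apply, Complex.real_smul, ← inner_smul_right]
        congr 1; ext j; simp [complexVec] }
  refine ⟨fun i => LinearMap.toContinuousLinearMap (φ i),
    LinearMap.toMatrix b.toBasis b.toBasis (complexOp L), fun x => ?_, fun i x => ?_,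
    fun i j hij => ?_, fun i j => ?_, fun i => ?_⟩
  · exact (b.sum_sq_norm_inner_right (complexVec x)).trans (by rw [norm_complexVec])
  · change inner ℂ (b i) (complexVec (L x)) = ∑ j, _ * inner ℂ (b j) (complexVec x)
    rw [← complexOp_complexVec]
    conv_lhs => rw [← b.sum_repr' (complexVec x), map_sum, inner_sum]
    refine Finset.sum_congr rfl fun j _ => ?_
    rw [map_smul, inner_smul_right, hT, mul_comm]
  · rw [hT, hb i j hij]
  · rw [hT]
    refine (norm_inner_le_norm _ _).trans ?_
    have := norm_complexOp_le L (b j)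
    simpa using this
  · apply isComplexEigenvalue_of_isRoot
    rw [← LinearMap.charpoly_toMatrix (complexOp L) b.toBasis, Matrix.charpoly_of_isUpperTriangular]
    · rw [Polynomial.IsRoot, Polynomial.eval_prod]
      exact Finset.prod_eq_zero (Finset.mem_univ i) (by simp)
    · intro k j hkj
      rw [hT, hb k j hkj]

theorem re_conj_mul_mul_le {M : ℝ} {t : ℂ} (ht : ‖t‖ ≤ M) (z w : ℂ) :
    (starRingEnd ℂ z * (t * w)).re ≤ M * ((‖z‖ ^ 2 + ‖w‖ ^ 2) / 2) := by
  refine (Complex.re_le_norm _).trans ?_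
  rw [norm_mul, norm_mul, RCLike.norm_conj]
  have : ‖z‖ * ‖w‖ ≤ (‖z‖ ^ 2 + ‖w‖ ^ 2) / 2 := by nlinarith [sq_nonneg (‖z‖ - ‖w‖)]
  calc ‖z‖ * (‖t‖ * ‖w‖) = ‖t‖ * (‖z‖ * ‖w‖) := by ring
    _ ≤ _ := mul_le_mul ht this (by positivity) ((norm_nonneg t).trans ht)

theorem re_conj_mul_mul_self (t z : ℂ) : (starRingEnd ℂ z * (t * z)).re = t.re * ‖z‖ ^ 2 := by
  rw [← Complex.normSq_eq_norm_sq, Complex.normSq_apply]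
  simp
  ring

theorem abs_le_opNorm_of_eigenvalue_re_le {L : E3 →L[ℝ] E3} {ℓ : ℝ} (hℓ : ℓ < 0)
    (hL : ∀ z : ℂ, IsComplexEigenvalue L z → z.re ≤ ℓ) : |ℓ| ≤ ‖L‖ := by
  obtain ⟨φ, T, -, -, -, hT, hev⟩ := exists_triangular_coordinates L
  have h1 := hL _ (hev 0)
  have h2 := (Complex.abs_re_le_norm _).trans (hT 0 0)
  rw [abs_of_neg hℓ]
  linarith [neg_abs_le (T 0 0).re]

/-! ### Lyapunov function and time spent near the shell. -/

/-- A quadratic Lyapunov function for a stable operator, with distortion controlled by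
`‖L‖ / |ℓ|`. -/
theorem exists_lyapunov {L : E3 →L[ℝ] E3} {ℓ : ℝ} (hℓ : ℓ < 0)
    (hL : ∀ z : ℂ, IsComplexEigenvalue L z → z.re ≤ ℓ) :
    ∃ Φ : E3 →L[ℝ] EuclideanSpace ℂ (Fin 3), ∀ x, ‖x‖ ≤ ‖Φ x‖ ∧
      ‖Φ x‖ ≤ 4 * (‖L‖ / |ℓ|) ^ 2 * ‖x‖ ∧ inner ℝ (Φ x) (Φ (L x)) ≤ ℓ / 2 * ‖Φ x‖ ^ 2 := by
  have hM := abs_le_opNorm_of_eigenvalue_re_le hℓ hL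
  obtain ⟨φ, T, hnorm, hφ, hT0, hT, hev⟩ := exists_triangular_coordinates L
  have hℓ' : 0 < |ℓ| := abs_pos.2 hℓ.ne
  set M := ‖L‖ with hMdef
  -- Giving the `i`-th Schur coordinate the weight `μ ^ i` divides the entry `T i j`, `i < j`, by `μ
  -- ^ (j - i)`. This `μ` makes every off-diagonal entry at most `|ℓ| / 2`. Each coordinate meets
  -- two of them, so together they cost half of the decay rate `|ℓ|`.
  set μ := 2 * (M / |ℓ|) with hμ
  have hμ1 : 1 ≤ μ := by
    have : 1 ≤ M / |ℓ| := (one_le_div hℓ').2 hM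
    linarith
  have hμM : M = μ * (-ℓ / 2) := by
    rw [hμ, abs_of_neg hℓ]
    have := hℓ.ne
    field_simp
  let Φ : E3 →ₗ[ℝ] EuclideanSpace ℂ (Fin 3) :=
    { toFun := fun x => WithLp.toLp 2 fun i => (μ ^ (i : ℕ) : ℝ) * φ i x
      map_add' := fun x y => by ext i; simp [mul_add]
      map_smul' := fun r x => by ext i; simp [mul_left_comm] }
  have hΦ : ∀ x i, Φ x i = (μ ^ (i : ℕ) : ℝ) * φ i x := fun _ _ => rfl
  have hΦn : ∀ x, ‖Φ x‖ ^ 2 = ∑ i : Fin 3, (μ ^ (i : ℕ)) ^ 2 * ‖φ i x‖ ^ 2 := fun x => by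
    rw [EuclideanSpace.norm_sq_eq]
    refine Finset.sum_congr rfl fun i _ => ?_
    rw [hΦ, norm_mul, Complex.norm_real, Real.norm_eq_abs, mul_pow, sq_abs]
  refine ⟨LinearMap.toContinuousLinearMap Φ, fun x => ⟨?_, ?_, ?_⟩⟩
  · refine abs_le_of_sq_le_sq' ?_ (norm_nonneg _) |>.2
    change _ ≤ ‖Φ x‖ ^ 2
    rw [hΦn, ← hnorm]
    refine Finset.sum_le_sum fun i _ => le_mul_of_one_le_left (by positivity) ?_
    exact one_le_pow₀ (one_le_pow₀ hμ1)
  · refine abs_le_of_sq_le_sq' ?_ (by positivity) |>.2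
    change ‖Φ x‖ ^ 2 ≤ _
    rw [hΦn, mul_pow, ← hnorm, Finset.mul_sum]
    refine Finset.sum_le_sum fun i _ => ?_
    gcongr ?_ ^ 2 * _
    calc μ ^ (i : ℕ) ≤ μ ^ 2 := pow_le_pow_right₀ hμ1 (by omega)
      _ = _ := by rw [hμ]; ring
  · change inner ℝ (Φ x) (Φ (L x)) ≤ ℓ / 2 * ‖Φ x‖ ^ 2
    have h00 := re_conj_mul_mul_self (T 0 0) (Φ x 0)
    have h11 := re_conj_mul_mul_self (T 1 1) (Φ x 1)
    have h22 := re_conj_mul_mul_self (T 2 2) (Φ x 2)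
    have h01 := re_conj_mul_mul_le (hT 0 1) (Φ x 0) (Φ x 1)
    have h12 := re_conj_mul_mul_le (hT 1 2) (Φ x 1) (Φ x 2)
    have h02 := re_conj_mul_mul_le (hT 0 2) (Φ x 0) (Φ x 2)
    have e0 := mul_le_mul_of_nonneg_right (hL _ (hev 0)) (sq_nonneg ‖Φ x 0‖)
    have e1 := mul_le_mul_of_nonneg_right (hL _ (hev 1)) (sq_nonneg ‖Φ x 1‖)
    have e2 := mul_le_mul_of_nonneg_right (hL _ (hev 2)) (sq_nonneg ‖Φ x 2‖)
    have hμ0 : (μ : ℂ) ≠ 0 := by exact_mod_cast (by linarith : μ ≠ 0)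
    have hexp : inner ℝ (Φ x) (Φ (L x)) =
        (starRingEnd ℂ (Φ x 0) * (T 0 0 * Φ x 0)).re +
        (starRingEnd ℂ (Φ x 1) * (T 1 1 * Φ x 1)).re +
        (starRingEnd ℂ (Φ x 2) * (T 2 2 * Φ x 2)).re +
        μ⁻¹ * (starRingEnd ℂ (Φ x 0) * (T 0 1 * Φ x 1)).re +
        μ⁻¹ * (starRingEnd ℂ (Φ x 1) * (T 1 2 * Φ x 2)).re +
        μ⁻¹ ^ 2 * (starRingEnd ℂ (Φ x 0) * (T 0 2 * Φ x 2)).re := by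
      have h10 := hT0 1 0 (by decide)
      have h20 := hT0 2 0 (by decide)
      have h21 := hT0 2 1 (by decide)
      rw [PiLp.inner_apply]
      simp only [Complex.inner, Fin.sum_univ_three, ← Complex.re_ofReal_mul, ← Complex.add_re]
      congr 1
      simp only [hΦ, hφ, Fin.sum_univ_three, h10, h20, h21]
      push_cast
      simp
      field_simp
      ring
    have hsum : ‖Φ x‖ ^ 2 = ‖Φ x 0‖ ^ 2 + ‖Φ x 1‖ ^ 2 + ‖Φ x 2‖ ^ 2 := by
      rw [EuclideanSpace.norm_sq_eq, Fin.sum_univ_three]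
    have hμi : 0 < μ⁻¹ := by positivity
    have hμM' : μ⁻¹ * M = -ℓ / 2 := by rw [hμM]; field_simp
    have hμM2 : μ⁻¹ ^ 2 * M ≤ -ℓ / 2 := by
      rw [pow_two, mul_assoc, hμM']
      exact mul_le_of_le_one_left (by linarith) (inv_le_one_of_one_le₀ hμ1)
    have f01 := mul_le_mul_of_nonneg_left h01 hμi.le
    have f12 := mul_le_mul_of_nonneg_left h12 hμi.le
    have f02 := mul_le_mul_of_nonneg_left h02 (sq_nonneg μ⁻¹)
    rw [← mul_assoc μ⁻¹ M, hμM'] at f01 f12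
    rw [← mul_assoc _ M] at f02
    have f02' := f02.trans (mul_le_mul_of_nonneg_right hμM2 (by positivity))
    rw [hexp, hsum, h00, h11, h22]
    linarith

/-- Near a sink the length of a time interval between two passages of a trajectory through the
shell `r ≤ ‖x‖ ≤ R` is bounded. -/
theorem abs_sub_le_of_mem_shellPart {v : E3 → E3} {U : Set E3} {I : Set ℝ} {ω : ℝ → E3}
    {L : E3 →L[ℝ] E3} {ℓ : ℝ} (hℓ : ℓ < 0)
    (hL : ∀ z : ℂ, IsComplexEigenvalue L z → z.re ≤ ℓ)
    (hU : ∀ y ∈ U, ‖v y - L y‖ ≤ |ℓ| / (16 * (‖L‖ / |ℓ|) ^ 2) * ‖y‖)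
    (hω : IsTrajectoryIn v U I ω) {r R : ℝ} (hr : 0 < r) {t₁ t₂ : ℝ}
    (h₁ : t₁ ∈ shellPart ω I r R) (h₂ : t₂ ∈ shellPart ω I r R) :
    t₂ - t₁ ≤ (4 * Real.log (R / r) + 8 * Real.log (‖L‖ / |ℓ|) + 6) / |ℓ| := by
  have hℓ' : 0 < |ℓ| := abs_pos.2 hℓ.ne
  have hκ : 1 ≤ ‖L‖ / |ℓ| := (one_le_div hℓ').2 (abs_le_opNorm_of_eigenvalue_re_le hℓ hL)
  obtain ⟨Φ, hΦ⟩ := exists_lyapunov hℓ hL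
  set κ := ‖L‖ / |ℓ| with hκdef
  have hκ0 : 0 < κ := by linarith
  have hrR : r ≤ R := h₁.2.1.trans h₁.2.2
  have hR : 0 < R := hr.trans_le hrR
  have hlogκ : 0 ≤ Real.log κ := Real.log_nonneg hκ
  have hlogR : 0 ≤ Real.log (R / r) := Real.log_nonneg ((one_le_div hr).2 hrR)
  rcases lt_or_ge t₂ t₁ with h21 | h12
  · exact (sub_neg.2 h21).le.trans (by positivity)
  have hsub : Set.Icc t₁ t₂ ⊆ I := hω.interval.out h₁.1 h₂.1
  have hderiv : ∀ t ∈ Set.Icc t₁ t₂,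
      HasDerivWithinAt (fun s => Real.exp (-(ℓ / 2) * s) * ‖Φ (ω s)‖ ^ 2)
      (Real.exp (-(ℓ / 2) * t) * (2 * inner ℝ (Φ (ω t)) (Φ (v (ω t))) - ℓ / 2 * ‖Φ (ω t)‖ ^ 2))
      (Set.Icc t₁ t₂) t := by
    intro t ht
    have hd := (Φ.hasFDerivAt.comp_hasDerivWithinAt t ((hω.hasDeriv t (hsub ht)).mono hsub)).norm_sq
    have he : HasDerivWithinAt (fun s => Real.exp (-(ℓ / 2) * s))
        (Real.exp (-(ℓ / 2) * t) * (-(ℓ / 2))) (Set.Icc t₁ t₂) t := by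
      simpa using ((hasDerivAt_id t).const_mul (-(ℓ / 2))).exp.hasDerivWithinAt
    refine (he.mul hd).congr_deriv ?_
    simp only [Function.comp]
    ring
  have hnonpos : ∀ t ∈ Set.Icc t₁ t₂,
      2 * inner ℝ (Φ (ω t)) (Φ (v (ω t))) - ℓ / 2 * ‖Φ (ω t)‖ ^ 2 ≤ 0 := by
    intro t ht
    set x := ω t with hx
    obtain ⟨ha, -, hc⟩ := hΦ x
    have hg : inner ℝ (Φ x) (Φ (v x)) = inner ℝ (Φ x) (Φ (L x)) + inner ℝ (Φ x) (Φ (v x - L x)) := by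
      rw [map_sub, inner_sub_right]; ring
    have hg2 : inner ℝ (Φ x) (Φ (v x - L x)) ≤ |ℓ| / 4 * ‖Φ x‖ ^ 2 := by
      calc inner ℝ (Φ x) (Φ (v x - L x)) ≤ ‖Φ x‖ * ‖Φ (v x - L x)‖ := real_inner_le_norm _ _
        _ ≤ ‖Φ x‖ * (4 * κ ^ 2 * (|ℓ| / (16 * κ ^ 2) * ‖Φ x‖)) := by
          refine mul_le_mul_of_nonneg_left ?_ (norm_nonneg _)
          exact (hΦ _).2.1.trans (mul_le_mul_of_nonneg_left ((hU x (hω.mem t (hsub ht))).trans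
            (mul_le_mul_of_nonneg_left ha (by positivity))) (by positivity))
        _ = _ := by field_simp; norm_num
    rw [hg]
    rw [abs_of_neg hℓ] at hg2
    linarith
  have hanti : AntitoneOn (fun s => Real.exp (-(ℓ / 2) * s) * ‖Φ (ω s)‖ ^ 2) (Set.Icc t₁ t₂) := by
    refine antitoneOn_of_hasDerivWithinAt_nonpos (convex_Icc t₁ t₂)
      (fun t ht => (hderiv t ht).continuousWithinAt)
      (fun t ht => (hderiv t (interior_subset ht)).mono interior_subset) fun t ht => ?_
    exact mul_nonpos_of_nonneg_of_nonpos (Real.exp_pos _).le (hnonpos t (interior_subset ht))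
  have hle := hanti (Set.left_mem_Icc.2 h12) (Set.right_mem_Icc.2 h12) h12
  have hlow : r ≤ ‖Φ (ω t₂)‖ := h₂.2.1.trans (hΦ _).1
  have hup : ‖Φ (ω t₁)‖ ≤ 4 * κ ^ 2 * R :=
    (hΦ _).2.1.trans (mul_le_mul_of_nonneg_left h₁.2.2 (by positivity))
  have hexp : Real.exp (-(ℓ / 2) * t₂) * r ^ 2 ≤ Real.exp (-(ℓ / 2) * t₁) * (4 * κ ^ 2 * R) ^ 2 :=
    calc _ ≤ Real.exp (-(ℓ / 2) * t₂) * ‖Φ (ω t₂)‖ ^ 2 := by gcongr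
      _ ≤ Real.exp (-(ℓ / 2) * t₁) * ‖Φ (ω t₁)‖ ^ 2 := hle
      _ ≤ _ := by gcongr
  -- Logarithms give `|ℓ| (t₂ - t₁) ≤ 4 log (R / r) + 8 log κ + 8 log 2`, and `8 log 2 < 6`.
  have hlog := Real.log_le_log (by positivity) hexp
  rw [Real.log_mul (by positivity) (by positivity), Real.log_mul (by positivity) (by positivity),
    Real.log_exp, Real.log_exp, Real.log_pow, Real.log_pow, Real.log_mul (by positivity) hR.ne',
    Real.log_mul (by positivity) (by positivity), Real.log_pow,
    show (4 : ℝ) = 2 ^ 2 by norm_num, Real.log_pow] at hlog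
  rw [le_div_iff₀ hℓ', Real.log_div hR.ne' hr.ne', abs_of_neg hℓ]
  have := Real.log_two_lt_d9
  push_cast at hlog
  nlinarith

/-! ### Arbitrary time intervals and long times. -/

/-- An analytic field is close to its linear part in the Lipschitz sense near the origin. -/
theorem exists_nhds_approximates {v : E3 → E3} {L : E3 →L[ℝ] E3} (hv : AnalyticAt ℝ v 0)
    (hL : HasFDerivAt v L 0) {δ : ℝ} (hδ : 0 < δ) :
    ∃ U ∈ 𝓝 (0 : E3), ∀ x ∈ U, ∀ y ∈ U, ‖v x - v y - L (x - y)‖ ≤ δ * ‖x - y‖ := by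
  have h := hv.hasStrictFDerivAt
  rw [hL.fderiv] at h
  obtain ⟨U, hU, hap⟩ := h.approximates_deriv_on_nhds (c := ⟨δ, hδ.le⟩) (Or.inr hδ)
  exact ⟨U, hU, fun x hx y hy => hap x hx y hy⟩

theorem IsTrajectoryIn.mono {v : E3 → E3} {U : Set E3} {I J : Set ℝ} {ω : ℝ → E3}
    (h : IsTrajectoryIn v U I ω) (hJI : J ⊆ I) (hJ : J.OrdConnected) : IsTrajectoryIn v U J ω :=
  ⟨hJ, fun t ht => h.mem t (hJI ht), fun t ht => (h.hasDeriv t (hJI ht)).mono hJI⟩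

theorem IsTrajectoryIn.deriv_eq {v : E3 → E3} {U : Set E3} {I : Set ℝ} {ω : ℝ → E3}
    (h : IsTrajectoryIn v U I ω) {t : ℝ} (ht : t ∈ interior I) : deriv ω t = v (ω t) :=
  ((h.hasDeriv t (interior_subset ht)).hasDerivAt (mem_interior_iff_mem_nhds.1 ht)).deriv

/-- At an endpoint of the time interval `deriv ω` need not equal `v (ω t)`; endpoints form a null
set, so the integrals can be taken over the interior. -/
theorem Set.OrdConnected.interior_ae_eq {I : Set ℝ} (h : I.OrdConnected) :
    interior I =ᵐ[volume] I :=
  interior_ae_eq_of_null_frontier (h.convex.addHaar_frontier volume)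

/-- The rotation of a trajectory of a `Λ`-Lipschitz field about a point moving with the field,
over a time interval of length at most `h`, not necessarily closed. -/
theorem lintegral_gauss_integrand_le_of_subset {v : E3 → E3} {U : Set E3} {Λ : ℝ} {γ : ℝ → E3}
    {J : Set ℝ} {a b : ℝ} {x : E3} (hΛ : 0 ≤ Λ) (hv : ∀ y ∈ U, ‖v y - v x‖ ≤ Λ * ‖y - x‖)
    (hγ : IsTrajectoryIn v U J γ) (hJ : J ⊆ Set.Icc a b) (hab : Λ * (b - a) ≤ 1 / 10) :
    ∫⁻ s in J, ENNReal.ofReal (|inner ℝ (wedge (v x) (v (γ s))) (γ s - x)| / ‖γ s - x‖ ^ 3) ≤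
      ENNReal.ofReal (20 * Λ) := by
  rw [← setLIntegral_congr hγ.interval.interior_ae_eq]
  have hIoo : ∃ c d : ℝ, interior J = Set.Ioo c d := by
    rcases (interior J).eq_empty_or_nonempty with h | h
    · exact ⟨0, 0, by simp [h]⟩
    have hconn : IsPreconnected (interior J) := hγ.interval.interior.isPreconnected
    have hbelow : BddBelow (interior J) := bddBelow_Icc.mono (interior_subset.trans hJ)
    have habove : BddAbove (interior J) := bddAbove_Icc.mono (interior_subset.trans hJ)
    refine ⟨sInf (interior J), sSup (interior J), Set.Subset.antisymm (fun t ht => ?_) ?_⟩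
    · obtain ⟨l, u, hlu, hs⟩ := mem_nhds_iff_exists_Ioo_subset.1 (isOpen_interior.mem_nhds ht)
      obtain ⟨l', hl'⟩ := exists_between hlu.1
      obtain ⟨u', hu'⟩ := exists_between hlu.2
      exact ⟨(csInf_le hbelow (hs ⟨hl'.1, hl'.2.trans hlu.2⟩)).trans_lt hl'.2,
        hu'.1.trans_le (le_csSup habove (hs ⟨hlu.1.trans hu'.1, hu'.2⟩))⟩
    · exact IsConnected.Ioo_csInf_csSup_subset ⟨h, hconn⟩ hbelow habove
  obtain ⟨c, d, hcd⟩ := hIoo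
  -- The bound on closed intervals uses a point of minimal distance, which an open interval may
  -- lack; monotone exhaustion transfers it.
  have hunion : interior J = ⋃ n : ℕ, Set.Icc (c + 1 / (n + 1 : ℝ)) (d - 1 / (n + 1 : ℝ)) := by
    rw [hcd]
    ext t
    simp only [Set.mem_Ioo, Set.mem_iUnion, Set.mem_Icc]
    constructor
    · rintro ⟨h1, h2⟩
      obtain ⟨n, hn⟩ := exists_nat_one_div_lt (lt_min (sub_pos.2 h1) (sub_pos.2 h2))
      have := lt_min_iff.1 hn
      exact ⟨n, by linarith [this.1], by linarith [this.2]⟩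
    · rintro ⟨n, h1, h2⟩
      have : (0 : ℝ) < 1 / (n + 1 : ℝ) := Nat.one_div_pos_of_nat
      exact ⟨by linarith, by linarith⟩
  have hmono : Monotone fun n : ℕ => Set.Icc (c + 1 / (n + 1 : ℝ)) (d - 1 / (n + 1 : ℝ)) := by
    intro m n hmn
    have : 1 / (n + 1 : ℝ) ≤ 1 / (m + 1 : ℝ) := Nat.one_div_le_one_div hmn
    exact Set.Icc_subset_Icc (by linarith) (by linarith)
  have hsub : ∀ n : ℕ, Set.Icc (c + 1 / (n + 1 : ℝ)) (d - 1 / (n + 1 : ℝ)) ⊆ J := fun n =>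
    (Set.subset_iUnion (fun n : ℕ => Set.Icc (c + 1 / (n + 1 : ℝ)) (d - 1 / (n + 1 : ℝ))) n).trans
      (hunion.symm.subset.trans interior_subset)
  rw [hunion, setLIntegral_iUnion_of_directed _ (directed_of_isDirected_le hmono)]
  refine iSup_le fun n => ?_
  rcases lt_or_ge (d - 1 / (n + 1 : ℝ)) (c + 1 / (n + 1 : ℝ)) with hlt | hle
  · rw [Set.Icc_eq_empty_of_lt hlt]
    simp
  refine lintegral_gauss_integrand_le hΛ hv (hγ.mono (hsub n) Set.ordConnected_Icc) ?_
  have h1 := hJ (hsub n (Set.left_mem_Icc.2 hle))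
  have h2 := hJ (hsub n (Set.right_mem_Icc.2 hle))
  exact (mul_le_mul_of_nonneg_left (by linarith [h1.1, h2.2]) hΛ).trans hab

/-- A set of reals of diameter at most `T` lies in an interval of length `T`. -/
theorem exists_subset_Icc_add {S : Set ℝ} {T : ℝ} (h : ∀ t₁ ∈ S, ∀ t₂ ∈ S, t₂ - t₁ ≤ T) :
    ∃ a : ℝ, S ⊆ Set.Icc a (a + T) := by
  rcases S.eq_empty_or_nonempty with rfl | ⟨t₀, ht₀⟩
  · exact ⟨0, Set.empty_subset _⟩
  have hbdd : BddBelow S := ⟨t₀ - T, fun t ht => by linarith [h t ht t₀ ht₀]⟩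
  refine ⟨sInf S, fun t ht => ⟨csInf_le hbdd ht, ?_⟩⟩
  have : t - T ≤ sInf S := le_csInf ⟨t₀, ht₀⟩ fun s hs => by linarith [h s hs t ht]
  linarith

/-- At most `10 Λ T + 1 ≤ 11 Λ T` windows of length `1 / (10 Λ)` cover the time, each costing `20
Λ`. -/
theorem lintegral_gauss_integrand_le_mul {v : E3 → E3} {U : Set E3} {Λ : ℝ} {γ : ℝ → E3}
    {I : Set ℝ} {a T : ℝ} {x : E3} (hΛ : 0 < Λ) (hv : ∀ y ∈ U, ‖v y - v x‖ ≤ Λ * ‖y - x‖)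
    (hγ : IsTrajectoryIn v U I γ) (hI : I ⊆ Set.Icc a (a + T)) (hT : 1 ≤ Λ * T) :
    ∫⁻ s in I, ENNReal.ofReal (|inner ℝ (wedge (v x) (deriv γ s)) (γ s - x)| / ‖γ s - x‖ ^ 3) ≤
      ENNReal.ofReal (220 * Λ ^ 2 * T) := by
  have hderiv : ∫⁻ s in I, ENNReal.ofReal
        (|inner ℝ (wedge (v x) (deriv γ s)) (γ s - x)| / ‖γ s - x‖ ^ 3) =
      ∫⁻ s in I, ENNReal.ofReal
        (|inner ℝ (wedge (v x) (v (γ s))) (γ s - x)| / ‖γ s - x‖ ^ 3) := by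
    rw [← setLIntegral_congr hγ.interval.interior_ae_eq,
      ← setLIntegral_congr hγ.interval.interior_ae_eq]
    exact setLIntegral_congr_fun isOpen_interior.measurableSet fun s hs => by
      simp only [hγ.deriv_eq hs]
  rw [hderiv]
  set h : ℝ := 1 / (10 * Λ) with hh
  have hh0 : 0 < h := by positivity
  have hΛh : Λ * h = 1 / 10 := by rw [hh]; field_simp
  set N : ℕ := ⌊T / h⌋₊ + 1 with hN
  let J : ℕ → Set ℝ := fun n => I ∩ Set.Icc (a + n * h) (a + n * h + h)
  have hcover : I ⊆ ⋃ n ∈ Finset.range N, J n := by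
    intro t ht
    have hta := hI ht
    have h0 : 0 ≤ (t - a) / h := div_nonneg (by linarith [hta.1]) hh0.le
    have h1 := Nat.floor_le h0
    have h2 := Nat.lt_floor_add_one ((t - a) / h)
    rw [le_div_iff₀ hh0] at h1
    rw [div_lt_iff₀ hh0] at h2
    simp only [Set.mem_iUnion]
    refine ⟨⌊(t - a) / h⌋₊, Finset.mem_range.2 (Nat.lt_succ_of_le (Nat.floor_mono ?_)), ht, ?_, ?_⟩
    · gcongr; linarith [hta.2]
    · linarith
    · linarith
  have hJ : ∀ n, ∫⁻ s in J n, ENNReal.ofReal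
      (|inner ℝ (wedge (v x) (v (γ s))) (γ s - x)| / ‖γ s - x‖ ^ 3) ≤ ENNReal.ofReal (20 * Λ) :=
    fun n => lintegral_gauss_integrand_le_of_subset hΛ.le hv
      (hγ.mono Set.inter_subset_left (hγ.interval.inter Set.ordConnected_Icc))
      Set.inter_subset_right (by rw [add_sub_cancel_left, hΛh])
  have hNle : (N : ℝ) ≤ 11 * (Λ * T) := by
    have hT0 : 0 ≤ T / h := div_nonneg (by nlinarith) hh0.le
    have h1 := Nat.floor_le hT0
    have h2 : T / h = 10 * (Λ * T) := by rw [hh]; field_simp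
    rw [hN]; push_cast
    linarith
  calc _ ≤ ∫⁻ s in ⋃ n ∈ Finset.range N, J n, ENNReal.ofReal
        (|inner ℝ (wedge (v x) (v (γ s))) (γ s - x)| / ‖γ s - x‖ ^ 3) := lintegral_mono_set hcover
    _ ≤ ∑ n ∈ Finset.range N, ∫⁻ s in J n, ENNReal.ofReal
        (|inner ℝ (wedge (v x) (v (γ s))) (γ s - x)| / ‖γ s - x‖ ^ 3) := by
        induction Finset.range N using Finset.induction_on with
        | empty => simp
        | insert n s hn ih =>
          rw [Finset.set_biUnion_insert, Finset.sum_insert hn]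
          exact (lintegral_union_le _ _ _).trans (add_le_add_right ih _)
    _ ≤ ∑ n ∈ Finset.range N, ENNReal.ofReal (20 * Λ) := Finset.sum_le_sum fun n _ => hJ n
    _ = ENNReal.ofReal (N * (20 * Λ)) := by
        rw [Finset.sum_const, Finset.card_range, nsmul_eq_mul,
          ENNReal.ofReal_mul N.cast_nonneg, ENNReal.ofReal_natCast]
    _ ≤ _ := by
        refine ENNReal.ofReal_le_ofReal ?_
        calc N * (20 * Λ) ≤ 11 * (Λ * T) * (20 * Λ) := by gcongr
          _ = _ := by ring

/-- Two trajectories of a `Λ`-Lipschitz field have absolute rotation at most a multiple of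
`(Λ T) ^ 2` during times of length `T ≥ 1 / Λ`. -/
theorem absRotation_le {v : E3 → E3} {U : Set E3} {Λ T : ℝ} (hΛ : 0 < Λ)
    (hv : ∀ x ∈ U, ∀ y ∈ U, ‖v y - v x‖ ≤ Λ * ‖y - x‖) (hT : 1 ≤ Λ * T)
    {I₁ I₂ S₁ S₂ : Set ℝ} {ω₁ ω₂ : ℝ → E3}
    (h₁ : IsTrajectoryIn v U I₁ ω₁) (h₂ : IsTrajectoryIn v U I₂ ω₂)
    (hS₁ : S₁ ⊆ I₁) (hS₂ : S₂ ⊆ I₂) (hd₁ : ∀ s ∈ S₁, ∀ t ∈ S₁, t - s ≤ T)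
    (hd₂ : ∀ s ∈ S₂, ∀ t ∈ S₂, t - s ≤ T) :
    absRotation ω₁ ω₂ S₁ S₂ ≤ ENNReal.ofReal (20 * (Λ * T) ^ 2) := by
  obtain ⟨a₁, ha₁⟩ := exists_subset_Icc_add hd₁
  obtain ⟨a₂, ha₂⟩ := exists_subset_Icc_add hd₂
  -- A trajectory may leave the shell and return, so `S₁` need not be an interval; it is enlarged to
  -- one of length at most `T`.
  set J₁ := I₁ ∩ Set.Icc a₁ (a₁ + T)
  set J₂ := I₂ ∩ Set.Icc a₂ (a₂ + T)
  have hJ₁ : IsTrajectoryIn v U J₁ ω₁ :=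
    h₁.mono Set.inter_subset_left (h₁.interval.inter Set.ordConnected_Icc)
  have hJ₂ : IsTrajectoryIn v U J₂ ω₂ :=
    h₂.mono Set.inter_subset_left (h₂.interval.inter Set.ordConnected_Icc)
  have hT0 : 0 ≤ T := by nlinarith
  have hin : ∀ t₁ ∈ interior J₁, ∫⁻ t₂ in S₂, ENNReal.ofReal
      (|inner ℝ (wedge (deriv ω₁ t₁) (deriv ω₂ t₂)) (ω₂ t₂ - ω₁ t₁)| / ‖ω₂ t₂ - ω₁ t₁‖ ^ 3) ≤
      ENNReal.ofReal (220 * Λ ^ 2 * T) := by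
    intro t₁ ht₁
    rw [hJ₁.deriv_eq ht₁]
    exact (lintegral_mono_set (Set.subset_inter hS₂ ha₂)).trans
      (lintegral_gauss_integrand_le_mul hΛ (hv _ (hJ₁.mem _ (interior_subset ht₁))) hJ₂
        Set.inter_subset_right hT)
  have hout : ∫⁻ t₁ in S₁, ∫⁻ t₂ in S₂, ENNReal.ofReal
      (|inner ℝ (wedge (deriv ω₁ t₁) (deriv ω₂ t₂)) (ω₂ t₂ - ω₁ t₁)| / ‖ω₂ t₂ - ω₁ t₁‖ ^ 3) ≤
      ENNReal.ofReal (220 * Λ ^ 2 * T) * ENNReal.ofReal T := by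
    refine (lintegral_mono_set (Set.subset_inter hS₁ ha₁)).trans ?_
    rw [← setLIntegral_congr hJ₁.interval.interior_ae_eq]
    refine (setLIntegral_mono' isOpen_interior.measurableSet hin).trans ?_
    rw [setLIntegral_const]
    gcongr
    refine (measure_mono (interior_subset.trans Set.inter_subset_right)).trans ?_
    rw [Real.volume_Icc, add_sub_cancel_left]
  refine (mul_le_mul_right hout _).trans ?_
  rw [← ENNReal.ofReal_mul (by positivity), ← ENNReal.ofReal_mul (by positivity)]
  refine ENNReal.ofReal_le_ofReal ?_
  -- `220 / (4 π) < 20`.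
  have hpi := Real.pi_gt_three
  rw [one_div_mul_eq_div, div_le_iff₀ (by positivity)]
  have : 0 ≤ (Λ * T) ^ 2 := sq_nonneg _
  nlinarith

/-! ### Assembly and constants. -/

theorem theorem3p10 (q : ℝ) (hq : 1 < q) :
    ∃ c : ℝ, 0 < c ∧
      ∀ (L : E3 →L[ℝ] E3) (ℓ : ℝ), ℓ < 0 →
        (∀ z : ℂ, IsComplexEigenvalue L z → z.re ≤ ℓ) →
      ∀ v : E3 → E3, AnalyticAt ℝ v 0 → v 0 = 0 → HasFDerivAt v L 0 →
      ∃ U ∈ 𝓝 (0 : E3),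
        ∀ (I₁ I₂ : Set ℝ) (ω₁ ω₂ : ℝ → E3),
          IsTrajectoryIn v U I₁ ω₁ → IsTrajectoryIn v U I₂ ω₂ →
        ∀ r R : ℝ, 0 < r → q * r ≤ R →
          absRotation ω₁ ω₂ (shellPart ω₁ I₁ r R) (shellPart ω₂ I₂ r R) ≤
              ENNReal.ofReal
                ((c * (‖L‖ / |ℓ|) * (1 + Real.log (‖L‖ / |ℓ|)) ^ 2) *
                  ‖L‖ * (Real.log (R / r) ^ 2 / |ℓ|)) ∧
          (Real.exp 1 * (‖L‖ / |ℓ|) * r ≤ R →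
            absRotation ω₁ ω₂ (shellPart ω₁ I₁ r R) (shellPart ω₂ I₂ r R) ≤
              ENNReal.ofReal
                ((c * (‖L‖ / |ℓ|)) * ‖L‖ * (Real.log (R / r) ^ 2 / |ℓ|))) := by
  have hq0 : 0 < Real.log q := Real.log_pos hq
  -- `80 = 20 · 2²` comes from `20 (Λ T)²` with `Λ = 2 ‖L‖`. The term `14 / log q` serves to absorb
  -- `8 log κ + 6` through `log q ≤ log (R / r)`.
  refine ⟨80 * (18 + 14 / Real.log q) ^ 2, by positivity, ?_⟩
  intro L ℓ hℓ hL v hv hv0 hvL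
  set A := 18 + 14 / Real.log q with hA
  have hℓ' : 0 < |ℓ| := abs_pos.2 hℓ.ne
  have hM := abs_le_opNorm_of_eigenvalue_re_le hℓ hL
  have hM0 : 0 < ‖L‖ := hℓ'.trans_le hM
  have hκ : 1 ≤ ‖L‖ / |ℓ| := (one_le_div hℓ').2 hM
  set κ := ‖L‖ / |ℓ| with hκdef
  have hκ0 : 0 < κ := by linarith
  have hlogκ : 0 ≤ Real.log κ := Real.log_nonneg hκ
  have hδM : |ℓ| / (16 * κ ^ 2) ≤ ‖L‖ := by
    refine (div_le_self hℓ'.le ?_).trans hM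
    nlinarith
  -- One tolerance serves twice: it preserves the Lyapunov decay, and being at most `‖L‖` it gives
  -- the Lipschitz constant `2 ‖L‖`.
  obtain ⟨U, hU, hap⟩ := exists_nhds_approximates hv hvL
    (δ := |ℓ| / (16 * κ ^ 2)) (by positivity)
  refine ⟨U, hU, ?_⟩
  intro I₁ I₂ ω₁ ω₂ h₁ h₂ r R hr hqr
  have hlip : ∀ x ∈ U, ∀ y ∈ U, ‖v y - v x‖ ≤ 2 * ‖L‖ * ‖y - x‖ := by
    intro x hx y hy
    calc ‖v y - v x‖ = ‖(v y - v x - L (y - x)) + L (y - x)‖ := by rw [sub_add_cancel]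
      _ ≤ |ℓ| / (16 * κ ^ 2) * ‖y - x‖ + ‖L‖ * ‖y - x‖ :=
        (norm_add_le _ _).trans (add_le_add (hap y hy x hx) (L.le_opNorm _))
      _ ≤ ‖L‖ * ‖y - x‖ + ‖L‖ * ‖y - x‖ := by gcongr
      _ = _ := by ring
  have hlin : ∀ y ∈ U, ‖v y - L y‖ ≤ |ℓ| / (16 * κ ^ 2) * ‖y‖ := fun y hy => by
    simpa [hv0] using hap y hy 0 (mem_of_mem_nhds hU)
  have hρ : Real.log q ≤ Real.log (R / r) :=
    Real.log_le_log (by linarith) ((le_div_iff₀ hr).2 hqr)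
  set ρ := Real.log (R / r) with hρdef
  set T := (4 * ρ + 8 * Real.log κ + 6) / |ℓ| with hTdef
  have hΛT : 2 * ‖L‖ * T = 2 * κ * (4 * ρ + 8 * Real.log κ + 6) := by
    rw [hTdef, hκdef]; field_simp
  have hmain := absRotation_le (Λ := 2 * ‖L‖) (T := T) (by positivity) hlip
    (by rw [hΛT]; nlinarith) h₁ h₂ (S₁ := shellPart ω₁ I₁ r R) (S₂ := shellPart ω₂ I₂ r R)
    (fun t ht => ht.1) (fun t ht => ht.1)
    (fun s hs t ht => abs_sub_le_of_mem_shellPart hℓ hL hlin h₁ hr hs ht)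
    (fun s hs t ht => abs_sub_le_of_mem_shellPart hℓ hL hlin h₂ hr hs ht)
  rw [hΛT] at hmain
  have h14 : 14 ≤ 14 / Real.log q * ρ := by
    rw [div_mul_eq_mul_div, le_div_iff₀ hq0]; linarith
  have hfinal : ∀ B : ℝ, 4 * ρ + 8 * Real.log κ + 6 ≤ A * ρ * B →
      20 * (2 * κ * (4 * ρ + 8 * Real.log κ + 6)) ^ 2 ≤
        80 * A ^ 2 * κ * B ^ 2 * ‖L‖ * (ρ ^ 2 / |ℓ|) := by
    intro B hB
    calc 20 * (2 * κ * (4 * ρ + 8 * Real.log κ + 6)) ^ 2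
        ≤ 20 * (2 * κ * (A * ρ * B)) ^ 2 := by
          have : 0 ≤ 4 * ρ + 8 * Real.log κ + 6 := by linarith
          gcongr
      _ = 80 * A ^ 2 * κ * B ^ 2 * κ * ρ ^ 2 := by ring
      _ = _ := by rw [hκdef]; ring
  refine ⟨hmain.trans (ENNReal.ofReal_le_ofReal (hfinal _ ?_)), fun hR =>
    hmain.trans (ENNReal.ofReal_le_ofReal ?_)⟩
  · have h1 : 14 * Real.log κ ≤ 14 / Real.log q * ρ * Real.log κ := by gcongr
    have h2 : 0 ≤ ρ * Real.log κ := mul_nonneg (hq0.le.trans hρ) hlogκ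
    rw [hA]
    nlinarith
  · have hρκ : 1 + Real.log κ ≤ ρ := by
      rw [← Real.log_exp 1, ← Real.log_mul (Real.exp_pos 1).ne' hκ0.ne']
      exact Real.log_le_log (by positivity) ((le_div_iff₀ hr).2 hR)
    -- Here `8 log κ + 6 ≤ 8 ρ`, so no factor `1 + log κ` is needed.
    have h := hfinal 1 (by rw [hA]; nlinarith)
    simpa using h
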